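/- Let $\Gamma$ be a discrete group acting by homeomorphisms on a compact Hausdorff space $X$. Suppose that the action has north pole--south pole dynamics: every $g\in\Gamma$ of infinite order has precisely two fixed points $x_g^+\neq x_g^-$ in $X$, and $g^nx\to x_g^+$ as $n\to\infty$ for every $x\in X\setminus\{x_g^-\}$. Let $s\in\Gamma$ be an element of infinite order with corresponding fixed points $x_s^+,x_s^-$, and assume that $t\{x_s^+,x_s^-\}\cap\{x_s^+,x_s^-\}=\emptyset$ for all $t\in\Gamma\setminus\langle s\rangle$. Let $\lambda$ be the left regular representation of $\Gamma$ on $\ell^2(\Gamma)$, $(\lambda(g)\xi)(h)=\xi(g^{-1}h)$, let $C_r^*(\Gamma)\subset\mathbb{B}(\ell^2(\Gamma))$ be the C*-algebra generated by $\lambda(\Gamma)$, and let $C_r^*(\langle s\rangle)\subset C_r^*(\Gamma)$ be the C*-subalgebra generated by $\lambda(\langle s\rangle)$. Let $\mathbb{E}_s:C_r^*(\Gamma)\to C_r^*(\langle s\rangle)$ be the canonical conditional expectation, that is, the bounded linear map with $\mathbb{E}_s(\lambda(t))=\lambda(t)$ for $t\in\langle s\rangle$ and $\mathbb{E}_s(\lambda(t))=0$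 for $t\notin\langle s\rangle$. Let $n_1<n_2<\cdots$ be any strictly increasing sequence of natural numbers. Then for any finitely many elements $a_1,\dots,a_k\in C_r^*(\Gamma)$ and every $\epsilon>0$ there are $m\geq 1$ and (not necessarily distinct) elements $s_1,\dots,s_m\in\{s^{n_j}:j\in\mathbb{N}\}$ such that \[\left\|\frac1m\sum_{j=1}^m\lambda(s_j)\,a_i\,\lambda(s_j)^*-\mathbb{E}_s(a_i)\right\|<\epsilon\qquad\text{for all } i=1,\dots,k.\] -/

import Mathlib

open Filter Topology
open scoped ENNReal lp

/-- The Hilbert space `ℓ²(Γ)` of square summable complex functions on a (discrete) set `Γ`. -/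
abbrev EllTwo (Γ : Type*) : Type _ := lp (fun _ : Γ => ℂ) 2

namespace EllTwo

theorem sum_sq_le {ι : Type*} (ξ : EllTwo ι) (S : Finset ι) :
    ∑ i ∈ S, ‖ξ i‖ ^ 2 ≤ ‖ξ‖ ^ 2 := by
  have h := lp.sum_rpow_le_norm_rpow (p := 2) (by norm_num) ξ S
  simpa using h

theorem norm_le_of_sum_sq {ι : Type*} (ξ : EllTwo ι) {C : ℝ} (hC : 0 ≤ C)
    (h : ∀ S : Finset ι, ∑ i ∈ S, ‖ξ i‖ ^ 2 ≤ C ^ 2) : ‖ξ‖ ≤ C :=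
  lp.norm_le_of_forall_sum_le (p := 2) (by norm_num) hC (fun S => by simpa using h S)

theorem memℓp_of_sum_sq {ι : Type*} {f : ι → ℂ} {C : ℝ}
    (h : ∀ S : Finset ι, ∑ i ∈ S, ‖f i‖ ^ 2 ≤ C) : Memℓp (E := fun _ : ι => ℂ) f 2 :=
  memℓp_gen' (C := C) (fun S => by simpa using h S)

/-- Left translation `(λ_g ξ)(h) = ξ(g⁻¹ h)` as a bounded operator on `ℓ²(Γ)`. -/
noncomputable def translate {Γ : Type*} [Group Γ] (g : Γ) : EllTwo Γ →L[ℂ] EllTwo Γ :=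
  LinearMap.mkContinuous
    { toFun := fun ξ => ⟨fun h => ξ (g⁻¹ * h), memℓp_of_sum_sq (C := ‖ξ‖ ^ 2) (fun S => by
        have := sum_sq_le ξ (S.map (Equiv.mulLeft g⁻¹).toEmbedding)
        simpa using this)⟩
      map_add' := fun _ _ => rfl
      map_smul' := fun _ _ => rfl } 1 (fun ξ => by
        rw [one_mul]
        refine norm_le_of_sum_sq _ (norm_nonneg _) (fun S => ?_)
        have := sum_sq_le ξ (S.map (Equiv.mulLeft g⁻¹).toEmbedding)
        rw [Finset.sum_map] at this
        exact this)

@[simp] theorem translate_apply {Γ : Type*} [Group Γ] (g : Γ) (ξ : EllTwo Γ) (h : Γ) :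
    translate g ξ h = ξ (g⁻¹ * h) := rfl

/-- Multiplication by the indicator function of `A`: the orthogonal projection of `ℓ²(ι)`
onto `ℓ²(A)`. -/
noncomputable def cutoff {ι : Type*} (A : Set ι) : EllTwo ι →L[ℂ] EllTwo ι :=
  LinearMap.mkContinuous
    { toFun := fun ξ => ⟨A.indicator (ξ : ι → ℂ), memℓp_of_sum_sq (C := ‖ξ‖ ^ 2) (fun S =>
        (Finset.sum_le_sum (fun i _ => pow_le_pow_left₀ (norm_nonneg _)
          (norm_indicator_le_norm_self _ i) 2)).trans (sum_sq_le ξ S))⟩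
      map_add' := fun ξ η => by
        ext i; exact congrFun (Set.indicator_add A (ξ : ι → ℂ) (η : ι → ℂ)) i
      map_smul' := fun c ξ => by
        ext i; exact congrFun (Set.indicator_const_smul A c (ξ : ι → ℂ)) i } 1 (fun ξ => by
        rw [one_mul]
        refine norm_le_of_sum_sq _ (norm_nonneg _) (fun S => ?_)
        exact (Finset.sum_le_sum (fun i _ => pow_le_pow_left₀ (norm_nonneg _)
          (norm_indicator_le_norm_self _ i) 2)).trans (sum_sq_le ξ S))

theorem cutoff_apply {ι : Type*} (A : Set ι) (ξ : EllTwo ι) (i : ι) :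
    cutoff A ξ i = A.indicator (ξ : ι → ℂ) i := rfl

theorem sum_cutoff_sq_le {ι Q : Type*} (q : ι → Q) (ξ : EllTwo ι) (T : Finset Q) :
    ∑ c ∈ T, ‖cutoff (q ⁻¹' {c}) ξ‖ ^ 2 ≤ ‖ξ‖ ^ 2 := by
  classical
  have key : ∀ c, HasSum (fun i => ‖cutoff (q ⁻¹' {c}) ξ i‖ ^ 2)
      (‖cutoff (q ⁻¹' {c}) ξ‖ ^ 2) := fun c => by
    have := lp.hasSum_norm (p := 2) (by norm_num) (cutoff (q ⁻¹' {c}) ξ)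
    simpa using this
  have h0 : HasSum (fun i => ‖ξ i‖ ^ 2) (‖ξ‖ ^ 2) := by
    have := lp.hasSum_norm (p := 2) (by norm_num) ξ
    simpa using this
  refine hasSum_le (fun i => ?_) (hasSum_sum (s := T) (fun c _ => key c)) h0
  have : ∀ c, ‖cutoff (q ⁻¹' {c}) ξ i‖ ^ 2 = if q i = c then ‖ξ i‖ ^ 2 else 0 := by
    intro c
    rw [cutoff_apply]
    by_cases h : q i = c <;> simp [Set.indicator, h]
  simp only [this, Finset.sum_ite_eq]
  split_ifs
  · exact le_rfl
  · positivity

theorem sum_block_sq_le {ι Q : Type*} (q : ι → Q) (a : EllTwo ι →L[ℂ] EllTwo ι) (ξ : EllTwo ι)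
    (S : Finset ι) :
    ∑ i ∈ S, ‖a (cutoff (q ⁻¹' {q i}) ξ) i‖ ^ 2 ≤ (‖a‖ * ‖ξ‖) ^ 2 := by
  classical
  rw [← Finset.sum_fiberwise_of_maps_to (g := q) (t := S.image q)
    (fun i hi => Finset.mem_image_of_mem q hi)]
  calc _ ≤ ∑ c ∈ S.image q, ‖a‖ ^ 2 * ‖cutoff (q ⁻¹' {c}) ξ‖ ^ 2 := by
        refine Finset.sum_le_sum (fun c _ => ?_)
        calc _ = ∑ i ∈ S with q i = c, ‖a (cutoff (q ⁻¹' {c}) ξ) i‖ ^ 2 := by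
              refine Finset.sum_congr rfl (fun i hi => ?_)
              rw [(Finset.mem_filter.1 hi).2]
          _ ≤ ‖a (cutoff (q ⁻¹' {c}) ξ)‖ ^ 2 := sum_sq_le _ _
          _ ≤ _ := by
              rw [← mul_pow]
              exact pow_le_pow_left₀ (norm_nonneg _) (a.le_opNorm _) 2
    _ ≤ _ := by
        rw [← Finset.mul_sum, mul_pow]
        exact mul_le_mul_of_nonneg_left (sum_cutoff_sq_le q ξ _) (by positivity)

/-- The block diagonal part `∑_c P_c a P_c` of an operator `a` on `ℓ²(ι)`, where `P_c` is the
projection onto `ℓ²(q⁻¹ c)` for the fibres of `q : ι → Q`. -/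
noncomputable def blockDiag {ι Q : Type*} (q : ι → Q) :
    (EllTwo ι →L[ℂ] EllTwo ι) →L[ℂ] (EllTwo ι →L[ℂ] EllTwo ι) :=
  LinearMap.mkContinuous₂
    (LinearMap.mk₂ ℂ
      (fun (a : EllTwo ι →L[ℂ] EllTwo ι) (ξ : EllTwo ι) =>
        (⟨fun i => a (cutoff (q ⁻¹' {q i}) ξ) i,
          memℓp_of_sum_sq (sum_block_sq_le q a ξ)⟩ : EllTwo ι))
      (fun _ _ _ => rfl) (fun _ _ _ => rfl)
      (fun a ξ η => by ext i; simp; rfl)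
      (fun c a ξ => by ext i; simp))
    1 (fun a ξ => by
      rw [one_mul]
      exact norm_le_of_sum_sq _ (by positivity) (sum_block_sq_le q a ξ))

theorem blockDiag_apply {ι Q : Type*} (q : ι → Q) (a : EllTwo ι →L[ℂ] EllTwo ι) (ξ : EllTwo ι)
    (i : ι) : blockDiag q a ξ i = a (cutoff (q ⁻¹' {q i}) ξ) i := rfl

end EllTwo

/-- The left regular representation `λ` of `Γ` on `ℓ²(Γ)`. -/
noncomputable def leftRegularRep (Γ : Type*) [Group Γ] : Γ →* (EllTwo Γ →L[ℂ] EllTwo Γ) where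
  toFun := EllTwo.translate
  map_one' := by ext ξ h; simp
  map_mul' g₁ g₂ := by ext ξ h; simp [mul_assoc]

theorem leftRegularRep_apply {Γ : Type*} [Group Γ] (g : Γ) (ξ : EllTwo Γ) (h : Γ) :
    leftRegularRep Γ g ξ h = ξ (g⁻¹ * h) := rfl

theorem star_leftRegularRep {Γ : Type*} [Group Γ] (g : Γ) :
    star (leftRegularRep Γ g) = leftRegularRep Γ g⁻¹ := by
  rw [ContinuousLinearMap.star_eq_adjoint]
  symm
  rw [ContinuousLinearMap.eq_adjoint_iff]
  intro ξ η
  rw [lp.inner_eq_tsum, lp.inner_eq_tsum]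
  rw [← (Equiv.mulLeft g).tsum_eq (fun i => inner ℂ (ξ i) (leftRegularRep Γ g η i))]
  simp [leftRegularRep_apply]

/-- The C*-algebra generated by `λ(H)` inside `B(ℓ²(Γ))`: the canonical copy of `C*_r(H)` inside
`C*_r(Γ)`. -/
noncomputable def subgroupCStar {Γ : Type*} [Group Γ] (H : Subgroup Γ) :
    StarSubalgebra ℂ (EllTwo Γ →L[ℂ] EllTwo Γ) :=
  (StarAlgebra.adjoin ℂ (leftRegularRep Γ '' (H : Set Γ))).topologicalClosure

/-- The reduced group C*-algebra `C*_r(Γ)`, generated by `λ(Γ)` inside `B(ℓ²(Γ))`. -/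
noncomputable def reducedCStar (Γ : Type*) [Group Γ] :
    StarSubalgebra ℂ (EllTwo Γ →L[ℂ] EllTwo Γ) :=
  (StarAlgebra.adjoin ℂ (Set.range (leftRegularRep Γ))).topologicalClosure

theorem leftRegularRep_mem_reducedCStar {Γ : Type*} [Group Γ] (g : Γ) :
    leftRegularRep Γ g ∈ reducedCStar Γ :=
  StarSubalgebra.le_topologicalClosure _ (StarAlgebra.subset_adjoin ℂ _ ⟨g, rfl⟩)

/-- Finite linear combinations of the `λ(g)` are dense in `C*_r(Γ)`. -/
theorem reducedCStar_subset_closure_span (Γ : Type*) [Group Γ] :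
    (reducedCStar Γ : Set (EllTwo Γ →L[ℂ] EllTwo Γ)) ⊆
      closure ((Submodule.span ℂ (Set.range (leftRegularRep Γ)) :
        Submodule ℂ (EllTwo Γ →L[ℂ] EllTwo Γ)) : Set (EllTwo Γ →L[ℂ] EllTwo Γ)) := by
  have hstar : Set.range (leftRegularRep Γ) ∪ star (Set.range (leftRegularRep Γ))
      = (MonoidHom.mrange (leftRegularRep Γ) : Set _) := by
    rw [MonoidHom.coe_mrange, Set.union_eq_left]
    rintro x ⟨g, hg⟩
    exact ⟨g⁻¹, by rw [← star_leftRegularRep, hg, star_star]⟩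
  have h : (StarAlgebra.adjoin ℂ (Set.range (leftRegularRep Γ)) : Set _)
      = ((Submodule.span ℂ (Set.range (leftRegularRep Γ)) :
        Submodule ℂ (EllTwo Γ →L[ℂ] EllTwo Γ)) : Set (EllTwo Γ →L[ℂ] EllTwo Γ)) := by
    have h1 := StarAlgebra.adjoin_toSubalgebra ℂ (Set.range (leftRegularRep Γ))
    have h2 := Algebra.adjoin_eq_span ℂ
      (MonoidHom.mrange (leftRegularRep Γ) : Set (EllTwo Γ →L[ℂ] EllTwo Γ))
    rw [← hstar, ← h1, hstar, Submonoid.closure_eq, MonoidHom.coe_mrange] at h2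
    exact congrArg (fun M : Submodule ℂ (EllTwo Γ →L[ℂ] EllTwo Γ) =>
      (M : Set (EllTwo Γ →L[ℂ] EllTwo Γ))) h2
  rw [reducedCStar, StarSubalgebra.topologicalClosure_coe, h]

/-- The block diagonal part with respect to the decomposition of `Γ` into right cosets `Hg`. -/
noncomputable def cosetBlockDiag {Γ : Type*} [Group Γ] (H : Subgroup Γ) :
    (EllTwo Γ →L[ℂ] EllTwo Γ) →L[ℂ] (EllTwo Γ →L[ℂ] EllTwo Γ) :=
  EllTwo.blockDiag (Quotient.mk (QuotientGroup.rightRel H))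

open Classical in
/-- On the group elements the block diagonal part is the canonical conditional expectation:
it fixes `λ(t)` for `t ∈ H` and kills it for `t ∉ H`. -/
theorem cosetBlockDiag_leftRegularRep {Γ : Type*} [Group Γ] (H : Subgroup Γ) (t : Γ) :
    cosetBlockDiag H (leftRegularRep Γ t) = if t ∈ H then leftRegularRep Γ t else 0 := by
  ext ξ g
  have hq : (Quotient.mk (QuotientGroup.rightRel H) (t⁻¹ * g) =
      Quotient.mk (QuotientGroup.rightRel H) g) ↔ t ∈ H := by
    rw [Quotient.eq, QuotientGroup.rightRel_apply]
    simp
  rw [cosetBlockDiag, EllTwo.blockDiag_apply, leftRegularRep_apply, EllTwo.cutoff_apply]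
  by_cases h : t ∈ H
  · rw [Set.indicator_of_mem (by simpa using hq.2 h), if_pos h, leftRegularRep_apply]
  · rw [Set.indicator_of_notMem (by simpa using fun h' => h (hq.1 h')), if_neg h]
    rfl

theorem cosetBlockDiag_mem {Γ : Type*} [Group Γ] (H : Subgroup Γ)
    {a : EllTwo Γ →L[ℂ] EllTwo Γ} (ha : a ∈ reducedCStar Γ) :
    cosetBlockDiag H a ∈ subgroupCStar H := by
  have hcl : IsClosed (subgroupCStar H : Set (EllTwo Γ →L[ℂ] EllTwo Γ)) :=
    StarSubalgebra.isClosed_topologicalClosure _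
  refine closure_minimal (s := ((Submodule.span ℂ (Set.range (leftRegularRep Γ)) :
        Submodule ℂ (EllTwo Γ →L[ℂ] EllTwo Γ)) : Set (EllTwo Γ →L[ℂ] EllTwo Γ)))
    (t := cosetBlockDiag H ⁻¹' (subgroupCStar H : Set _)) ?_
    (hcl.preimage (cosetBlockDiag H).continuous) (reducedCStar_subset_closure_span Γ ha)
  intro x hx
  induction hx using Submodule.span_induction with
  | mem x hx =>
    obtain ⟨t, rfl⟩ := hx
    classical
    rw [Set.mem_preimage, cosetBlockDiag_leftRegularRep]
    split_ifs with h
    · exact StarSubalgebra.le_topologicalClosure _ (StarAlgebra.subset_adjoin ℂ _ ⟨t, h, rfl⟩)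
    · exact zero_mem (subgroupCStar H)
  | zero => simp
  | add x y _ _ hx hy =>
    rw [Set.mem_preimage, map_add]
    exact add_mem (S := StarSubalgebra ℂ (EllTwo Γ →L[ℂ] EllTwo Γ)) hx hy
  | smul c x _ hx =>
    rw [Set.mem_preimage, map_smul]
    exact (subgroupCStar H).smul_mem hx c

/-- The canonical conditional expectation `C*_r(Γ) → C*_r(H)`: the unique continuous linear map
with `λ(t) ↦ λ(t)` for `t ∈ H` and `λ(t) ↦ 0` for `t ∉ H`, realised as the block diagonal part
along the right cosets of `H`. -/
noncomputable def canonicalCondExp {Γ : Type*} [Group Γ] (H : Subgroup Γ) :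
    reducedCStar Γ →L[ℂ] subgroupCStar H where
  toFun a := ⟨cosetBlockDiag H a, cosetBlockDiag_mem H a.2⟩
  map_add' a b := Subtype.ext (map_add (cosetBlockDiag H) (a : EllTwo Γ →L[ℂ] EllTwo Γ) b)
  map_smul' c a := Subtype.ext (map_smul (cosetBlockDiag H) c (a : EllTwo Γ →L[ℂ] EllTwo Γ))
  cont := ((cosetBlockDiag H).continuous.comp continuous_subtype_val).subtype_mk _

open Classical in
theorem canonicalCondExp_leftRegularRep {Γ : Type*} [Group Γ] (H : Subgroup Γ) (t : Γ) :
    (canonicalCondExp H ⟨leftRegularRep Γ t, leftRegularRep_mem_reducedCStar t⟩ :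
      EllTwo Γ →L[ℂ] EllTwo Γ) = if t ∈ H then leftRegularRep Γ t else 0 :=
  cosetBlockDiag_leftRegularRep H t

/-- `xp` and `xm` are the attracting and the repelling pole of `g`: they are precisely the two
fixed points of `g`, and `gⁿ x → xp` for every `x ≠ xm`. -/
def IsPolePair {Γ X : Type*} [Group Γ] [TopologicalSpace X] [MulAction Γ X]
    (g : Γ) (xp xm : X) : Prop :=
  xp ≠ xm ∧ MulAction.fixedBy X g = {xp, xm} ∧
    ∀ x : X, x ≠ xm → Tendsto (fun n : ℕ => g ^ n • x) atTop (𝓝 xp)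

/-- North pole-south pole dynamics: every element of infinite order has a pair of poles. -/
def HasNorthSouthDynamics (Γ X : Type*) [Group Γ] [TopologicalSpace X] [MulAction Γ X] : Prop :=
  ∀ g : Γ, ¬ IsOfFinOrder g → ∃ xp xm : X, IsPolePair g xp xm

/-! Averaging over conjugates and the block diagonal part are both contractive, so it suffices to
treat finite sums of `λ(t)`. For `t ∈ ⟨s⟩` conjugation by powers of `s` changes nothing. For
finitely many `t ∉ ⟨s⟩`, one average of the `λ(s_j t s_j⁻¹)` must have small norm for all of them.

Choose a neighbourhood `U` of the poles that each of these `t` moves off itself, and let `B_j` be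
the set of `h` with `s_j⁻¹ h x₀ ∉ U`. The inverse of `s_j t s_j⁻¹` sends the complement of `B_j`
into `B_j`, and if each point lies in few of the `B_j`, this forces cancellation
(`norm_sum_leftRegularRep_le`).

Few overlaps come from the dynamics: `s^{-n} x` approaches the poles for every `x`, but not
uniformly. Riesz–Markov, dominated convergence and Hahn–Banach turn this pointwise convergence into
uniform smallness of suitable averages (`exists_sum_le_mul_of_tendsto_zero`). -/

namespace EllTwo

/-! ### Cutoffs with bounded overlap and cancellation of translations -/

theorem hasSum_norm_sq {ι : Type*} (ξ : EllTwo ι) : HasSum (fun i => ‖ξ i‖ ^ 2) (‖ξ‖ ^ 2) := by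
  have := lp.hasSum_norm (p := 2) (by norm_num) ξ
  simpa using this

theorem norm_le_of_norm_apply_le {ι : Type*} {ξ η : EllTwo ι} (h : ∀ i, ‖ξ i‖ ≤ ‖η i‖) :
    ‖ξ‖ ≤ ‖η‖ :=
  norm_le_of_sum_sq ξ (norm_nonneg _) fun S =>
    (Finset.sum_le_sum fun i _ => pow_le_pow_left₀ (norm_nonneg _) (h i) 2).trans (sum_sq_le η S)

theorem norm_cutoff_le {ι : Type*} (A : Set ι) (ξ : EllTwo ι) : ‖cutoff A ξ‖ ≤ ‖ξ‖ :=
  norm_le_of_norm_apply_le fun i => norm_indicator_le_norm_self _ i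

theorem norm_translate_le {Γ : Type*} [Group Γ] (g : Γ) (ξ : EllTwo Γ) :
    ‖translate g ξ‖ ≤ ‖ξ‖ := by
  simpa using (translate g).le_of_opNorm_le (LinearMap.mkContinuous_norm_le _ zero_le_one _) ξ

theorem norm_sq_cutoff_apply {ι : Type*} (A : Set ι) (ξ : EllTwo ι) (i : ι) :
    ‖cutoff A ξ i‖ ^ 2 = A.indicator 1 i * ‖ξ i‖ ^ 2 := by
  rw [cutoff_apply]
  by_cases h : i ∈ A <;> simp [h]

theorem sum_norm_sq_cutoff_le {ι J : Type*} [Fintype J] (B : J → Set ι) {c : ℝ}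
    (hB : ∀ i, ∑ j, (B j).indicator (1 : ι → ℝ) i ≤ c) (ξ : EllTwo ι) :
    ∑ j, ‖cutoff (B j) ξ‖ ^ 2 ≤ c * ‖ξ‖ ^ 2 := by
  refine hasSum_le (fun i => ?_) (hasSum_sum fun j _ => hasSum_norm_sq (cutoff (B j) ξ))
    ((hasSum_norm_sq ξ).mul_left c)
  simp only [norm_sq_cutoff_apply, ← Finset.sum_mul]
  exact mul_le_mul_of_nonneg_right (hB i) (by positivity)

/-- Dual to `sum_norm_sq_cutoff_le`: Cauchy–Schwarz at each point, where at most `c` summands are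
nonzero. -/
theorem norm_sq_sum_cutoff_le {ι J : Type*} [Fintype J] (B : J → Set ι) {c : ℝ}
    (hB : ∀ i, ∑ j, (B j).indicator (1 : ι → ℝ) i ≤ c) (ξ : J → EllTwo ι) :
    ‖∑ j, cutoff (B j) (ξ j)‖ ^ 2 ≤ c * ∑ j, ‖ξ j‖ ^ 2 := by
  refine hasSum_le (fun i => ?_) (hasSum_norm_sq (∑ j, cutoff (B j) (ξ j)))
    ((hasSum_sum fun j _ => hasSum_norm_sq (ξ j)).mul_left c)
  have hsum : (∑ j, cutoff (B j) (ξ j)) i = ∑ j, cutoff (B j) (ξ j) i := by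
    rw [lp.coeFn_sum, Finset.sum_apply]
  have hterm : ∀ j, ‖cutoff (B j) (ξ j) i‖ = (B j).indicator (1 : ι → ℝ) i * ‖ξ j i‖ := by
    intro j
    rw [cutoff_apply]
    by_cases h : i ∈ B j <;> simp [h]
  have hsq : ∀ j, (B j).indicator (1 : ι → ℝ) i ^ 2 = (B j).indicator (1 : ι → ℝ) i := by
    intro j
    by_cases h : i ∈ B j <;> simp [h]
  calc ‖(∑ j, cutoff (B j) (ξ j)) i‖ ^ 2
      ≤ (∑ j, (B j).indicator (1 : ι → ℝ) i * ‖ξ j i‖) ^ 2 := by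
        rw [hsum]
        refine pow_le_pow_left₀ (norm_nonneg _) ((norm_sum_le _ _).trans_eq ?_) 2
        exact Finset.sum_congr rfl fun j _ => hterm j
    _ ≤ (∑ j, (B j).indicator (1 : ι → ℝ) i ^ 2) * ∑ j, ‖ξ j i‖ ^ 2 :=
        Finset.sum_mul_sq_le_sq_mul_sq _ _ _
    _ ≤ c * ∑ j, ‖ξ j i‖ ^ 2 := by
        simp only [hsq]
        exact mul_le_mul_of_nonneg_right (hB i) (Finset.sum_nonneg fun _ _ => by positivity)

end EllTwo

theorem norm_leftRegularRep_le {Γ : Type*} [Group Γ] (g : Γ) : ‖leftRegularRep Γ g‖ ≤ 1 :=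
  ContinuousLinearMap.opNorm_le_bound _ zero_le_one fun ξ => by
    rw [one_mul]
    exact EllTwo.norm_translate_le g ξ

/-- If every `(g j)⁻¹` maps the complement of `B j` into `B j` and every point lies in at most `c`
of the sets `B j`, then the `λ(g j)` nearly cancel on average. -/
theorem norm_sum_leftRegularRep_le {Γ J : Type*} [Group Γ] [Fintype J] (g : J → Γ)
    (B : J → Set Γ) {c : ℝ} (hc : 0 ≤ c)
    (hB : ∀ h, ∑ j, (B j).indicator (1 : Γ → ℝ) h ≤ c)
    (hg : ∀ j h, h ∉ B j → (g j)⁻¹ * h ∈ B j) :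
    ‖∑ j, leftRegularRep Γ (g j)‖ ≤ 2 * √(c * Fintype.card J) := by
  refine ContinuousLinearMap.opNorm_le_bound _ (by positivity) fun ξ => ?_
  -- Off `B j`, the translate only sees values of `ξ` on `B j`. So each translate is localised on `B
  -- j` either in its output or in its input.
  have hsplit : ∀ j, leftRegularRep Γ (g j) ξ =
      EllTwo.cutoff (B j) (leftRegularRep Γ (g j) ξ) +
        EllTwo.cutoff (B j)ᶜ (leftRegularRep Γ (g j) (EllTwo.cutoff (B j) ξ)) := by
    intro j
    ext h
    rw [lp.coeFn_add, Pi.add_apply, EllTwo.cutoff_apply, EllTwo.cutoff_apply]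
    by_cases hh : h ∈ B j
    · simp [hh]
    · simp [hh, leftRegularRep_apply, EllTwo.cutoff_apply, hg j h hh]
  have hiso : ∀ j (η : EllTwo Γ), ‖leftRegularRep Γ (g j) η‖ ≤ ‖η‖ := fun j η =>
    EllTwo.norm_translate_le (g j) η
  have h1 : ‖∑ j, EllTwo.cutoff (B j) (leftRegularRep Γ (g j) ξ)‖ ≤
      √(c * Fintype.card J) * ‖ξ‖ := by
    refine le_of_sq_le_sq ?_ (by positivity)
    rw [mul_pow, Real.sq_sqrt (by positivity), mul_assoc]
    refine (EllTwo.norm_sq_sum_cutoff_le B hB _).trans (mul_le_mul_of_nonneg_left ?_ hc)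
    refine (Finset.sum_le_sum fun j _ => pow_le_pow_left₀ (norm_nonneg _) (hiso j ξ) 2).trans ?_
    simp
  have h2 : ‖∑ j, EllTwo.cutoff (B j)ᶜ (leftRegularRep Γ (g j) (EllTwo.cutoff (B j) ξ))‖ ≤
      √(c * Fintype.card J) * ‖ξ‖ := by
    refine (norm_sum_le _ _).trans ((Finset.sum_le_sum fun j _ =>
      (EllTwo.norm_cutoff_le _ _).trans (hiso j _)).trans ?_)
    refine le_of_sq_le_sq ?_ (by positivity)
    rw [mul_pow, Real.sq_sqrt (by positivity)]
    refine sq_sum_le_card_mul_sum_sq.trans ?_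
    have := EllTwo.sum_norm_sq_cutoff_le B hB ξ
    calc _ ≤ (Fintype.card J : ℝ) * (c * ‖ξ‖ ^ 2) := mul_le_mul_of_nonneg_left this (by positivity)
      _ = _ := by ring
  rw [sum_apply, Finset.sum_congr rfl fun j _ => hsplit j,
    Finset.sum_add_distrib]
  linarith [norm_add_le (∑ j, EllTwo.cutoff (B j) (leftRegularRep Γ (g j) ξ))
    (∑ j, EllTwo.cutoff (B j)ᶜ (leftRegularRep Γ (g j) (EllTwo.cutoff (B j) ξ)))]

/-! ### From pointwise to uniform convergence by averaging -/

section Averaging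

open MeasureTheory CompactlySupported

variable {X : Type*} [TopologicalSpace X]

/-- A functional which is bounded above on `{g | g < δ}` is positive. -/
theorem nonneg_of_forall_lt_const {δ : ℝ} (hδ : 0 < δ) (φ : StrongDual ℝ C(X, ℝ)) {r : ℝ}
    (hφ : ∀ g : C(X, ℝ), (∀ x, g x < δ) → φ g < r) {f : C(X, ℝ)} (hf : 0 ≤ f) : 0 ≤ φ f := by
  by_contra! hneg
  have hr : 0 < r := by simpa using hφ 0 fun _ => by simpa using hδ
  -- This multiple of `f` is nonpositive, hence below `δ`, yet `φ` takes the value `r` on it.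
  have h := hφ (-(r / -φ f) • f) fun x => by
    have h1 : 0 ≤ f x := hf x
    have h2 : 0 ≤ r / -φ f := div_nonneg hr.le (by linarith)
    have : (-(r / -φ f) • f) x = -(r / -φ f * f x) := by simp
    rw [this]
    nlinarith [mul_nonneg h2 h1]
  rw [map_smul, smul_eq_mul] at h
  have : -(r / -φ f) * φ f = r := by field_simp [hneg.ne]
  linarith

/-- Positive functionals on `C(X)` preserve limits of pointwise convergent bounded sequences. -/
theorem tendsto_zero_of_positive [CompactSpace X] [T2Space X] (φ : StrongDual ℝ C(X, ℝ))
    (hφ : ∀ f : C(X, ℝ), 0 ≤ f → 0 ≤ φ f) (u : ℕ → C(X, ℝ))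
    (h0 : ∀ l x, 0 ≤ u l x) (h1 : ∀ l x, u l x ≤ 1)
    (hu : ∀ x, Tendsto (fun l => u l x) atTop (𝓝 0)) :
    Tendsto (fun l => φ (u l)) atTop (𝓝 0) := by
  let _ : MeasurableSpace X := borel X
  have : BorelSpace X := ⟨rfl⟩
  let Λ : C_c(X, ℝ) →ₚ[ℝ] ℝ := PositiveLinearMap.mk₀
    { toFun := fun f => φ f.toContinuousMap
      map_add' := fun f g => map_add φ f.toContinuousMap g.toContinuousMap
      map_smul' := fun c f => map_smul φ c f.toContinuousMap }
    fun f hf => hφ _ hf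
  have hΛ : ∀ l, ∫ x, u l x ∂(RealRMK.rieszMeasure Λ) = φ (u l) := fun l =>
    RealRMK.integral_rieszMeasure Λ (CompactlySupportedContinuousMap.continuousMapEquiv (u l))
  simp only [← hΛ]
  rw [← integral_zero X ℝ (μ := RealRMK.rieszMeasure Λ)]
  refine tendsto_integral_of_dominated_convergence (fun _ => (1 : ℝ))
    (fun l => (u l).continuous.aestronglyMeasurable) (integrable_const _)
    (fun l => Eventually.of_forall fun x => ?_) (Eventually.of_forall hu)
  rw [Real.norm_of_nonneg (h0 l x)]
  exact h1 l x

/-- Mazur's theorem for bounded pointwise null sequences of nonnegative continuous functions. -/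
theorem exists_mem_convexHull_lt [CompactSpace X] [T2Space X] (u : ℕ → C(X, ℝ))
    (h0 : ∀ l x, 0 ≤ u l x) (h1 : ∀ l x, u l x ≤ 1)
    (hu : ∀ x, Tendsto (fun l => u l x) atTop (𝓝 0)) {δ : ℝ} (hδ : 0 < δ) :
    ∃ f ∈ convexHull ℝ (Set.range u), ∀ x, f x < δ := by
  by_contra! hcon
  have hopen : IsOpen {g : C(X, ℝ) | ∀ x, g x < δ} := by
    have := ContinuousMap.isOpen_setOfPred_mapsTo (X := X) (Y := ℝ) isCompact_univ
      (isOpen_Iio (a := δ))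
    simpa [Set.MapsTo] using this
  have hconv : Convex ℝ {g : C(X, ℝ) | ∀ x, g x < δ} := by
    intro f hf g hg a b ha hb hab x
    exact (convex_Iio (𝕜 := ℝ) δ) (hf x) (hg x) ha hb hab
  -- Separation gives `φ < r` on `{g | g < δ}` and `r ≤ φ (u l)`. Then `r > 0` and `φ` is positive,
  -- so `φ (u l) → 0` is a contradiction.
  obtain ⟨φ, r, hφ1, hφ2⟩ := geometric_hahn_banach_open hconv hopen
    (convex_convexHull ℝ (Set.range u)) (Set.disjoint_left.2 fun f hf hf' => by
      obtain ⟨x, hx⟩ := hcon f hf'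
      exact absurd (hf x) (not_lt.2 hx))
  have hr : 0 < r := by simpa using hφ1 0 fun _ => by simpa using hδ
  have hlim := tendsto_zero_of_positive φ
    (fun f hf => nonneg_of_forall_lt_const hδ φ hφ1 hf) u h0 h1 hu
  exact absurd (ge_of_tendsto' hlim fun l => hφ2 _ (subset_convexHull ℝ _ ⟨l, rfl⟩))
    (not_le.2 hr)

/-- The convex combinations in `exists_mem_convexHull_lt` may be taken with equal weights. -/
theorem exists_sum_le_mul_of_tendsto_zero [CompactSpace X] [T2Space X] (u : ℕ → C(X, ℝ))
    (h0 : ∀ l x, 0 ≤ u l x) (h1 : ∀ l x, u l x ≤ 1)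
    (hu : ∀ x, Tendsto (fun l => u l x) atTop (𝓝 0)) {δ : ℝ} (hδ : 0 < δ) :
    ∃ m : ℕ, 0 < m ∧ ∃ σ : Fin m → ℕ, ∀ x, ∑ j, u (σ j) x ≤ δ * m := by
  -- One half of `δ` bounds the convex combination, the other absorbs the rounding of its weights.
  obtain ⟨f, hf, hfδ⟩ := exists_mem_convexHull_lt u h0 h1 hu (half_pos hδ)
  obtain ⟨ι, _, w, z, hw0, hw1, hz, rfl⟩ := mem_convexHull_iff_exists_fintype.1 hf
  choose l hl using hz
  obtain ⟨M, hM⟩ := exists_nat_gt (Fintype.card ι / (δ / 2))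
  have hM0 : (0 : ℝ) < M := lt_of_le_of_lt (by positivity) hM
  rw [div_lt_iff₀ (half_pos hδ)] at hM
  -- The index `i` is repeated `N i` times. Rounding costs at most 1 per index, in total at most `M
  -- * (δ / 2)` by the choice of `M`.
  let N : ι → ℕ := fun i => ⌈M * w i⌉₊
  have hcard : (Fintype.card (Σ i, Fin (N i)) : ℝ) = ∑ i, (N i : ℝ) := by simp
  have hMm : (M : ℝ) ≤ Fintype.card (Σ i, Fin (N i)) := by
    rw [hcard]
    calc (M : ℝ) = ∑ i, M * w i := by rw [← Finset.mul_sum, hw1, mul_one]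
      _ ≤ _ := Finset.sum_le_sum fun i _ => Nat.le_ceil _
  refine ⟨Fintype.card (Σ i, Fin (N i)), by exact_mod_cast hM0.trans_le hMm,
    fun j => l ((Fintype.equivFin _).symm j).1, fun x => ?_⟩
  have hx : ∑ i, w i * u (l i) x < δ / 2 := by
    simpa [hl, ContinuousMap.sum_apply] using hfδ x
  calc ∑ j, u (l ((Fintype.equivFin (Σ i, Fin (N i))).symm j).1) x
      = ∑ j : Σ i, Fin (N i), u (l j.1) x :=
        (Fintype.equivFin _).symm.sum_comp fun j : Σ i, Fin (N i) => u (l j.1) x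
    _ = ∑ i, N i * u (l i) x := by simp [Fintype.sum_sigma]
    _ ≤ ∑ i, (M * (w i * u (l i) x) + 1) := Finset.sum_le_sum fun i _ => by
        have hN : (N i : ℝ) ≤ M * w i + 1 :=
          (Nat.ceil_lt_add_one (mul_nonneg hM0.le (hw0 i))).le
        nlinarith [mul_le_mul_of_nonneg_right hN (h0 (l i) x), h1 (l i) x]
    _ = M * ∑ i, w i * u (l i) x + Fintype.card ι := by
        simp [Finset.sum_add_distrib, Finset.mul_sum]
    _ ≤ δ * M := by nlinarith
    _ ≤ _ := mul_le_mul_of_nonneg_left hMm hδ.le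

end Averaging

/-! ### Conjugates of elements that move the poles -/

/-- A compact set `P` which finitely many homeomorphisms move off itself has a neighbourhood with
the same property. -/
theorem exists_isOpen_disjoint_smul {Γ X : Type*} [Group Γ] [TopologicalSpace X] [T2Space X]
    [MulAction Γ X] [ContinuousConstSMul Γ X] {P : Set X} (hP : IsCompact P) (F : Finset Γ)
    (hF : ∀ t ∈ F, Disjoint ((fun x : X => t • x) '' P) P) :
    ∃ U : Set X, IsOpen U ∧ P ⊆ U ∧ ∀ t ∈ F, ∀ x ∈ U, t • x ∉ U := by
  have hloc : ∀ t : Γ, ∃ U : Set X, IsOpen U ∧ P ⊆ U ∧ (t ∈ F → ∀ x ∈ U, t • x ∉ U) := by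
    intro t
    by_cases ht : t ∈ F
    · obtain ⟨V, W, hV, hW, hPV, hPW, hVW⟩ :=
        SeparatedNhds.of_isCompact_isCompact (hP.image (continuous_const_smul t)) hP (hF t ht)
      refine ⟨(fun x => t • x) ⁻¹' V ∩ W, (hV.preimage (continuous_const_smul t)).inter hW,
        fun x hx => ⟨hPV ⟨x, hx, rfl⟩, hPW hx⟩, fun _ x hx hx' => ?_⟩
      exact Set.disjoint_left.1 hVW hx.1 hx'.2
    · exact ⟨Set.univ, isOpen_univ, Set.subset_univ _, fun h => absurd h ht⟩
  choose U hU hPU hUt using hloc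
  refine ⟨⋂ t ∈ F, U t, isOpen_biInter_finset fun t _ => hU t,
    Set.subset_iInter₂ fun t _ => hPU t, fun t ht x hx hx' => ?_⟩
  exact hUt t ht x (Set.mem_iInter₂.1 hx t ht) (Set.mem_iInter₂.1 hx' t ht)

/-- If `(v l)⁻¹` attracts every point of `X` to a compact set `P` which is moved off itself by
all `t ∈ F`, then suitable averages of the conjugates of `λ(t)` by the `v l` are small. -/
theorem exists_norm_sum_conj_le {Γ X : Type*} [Group Γ] [TopologicalSpace X] [CompactSpace X]
    [T2Space X] [MulAction Γ X] [ContinuousConstSMul Γ X] {P : Set X} (hP : IsCompact P) (x₀ : X)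
    (v : ℕ → Γ)
    (hv : ∀ x, ∀ U : Set X, IsOpen U → P ⊆ U → ∀ᶠ l in atTop, (v l)⁻¹ • x ∈ U) (F : Finset Γ)
    (hF : ∀ t ∈ F, Disjoint ((fun x : X => t • x) '' P) P) {ε : ℝ} (hε : 0 < ε) :
    ∃ m : ℕ, 0 < m ∧ ∃ σ : Fin m → ℕ, ∀ t ∈ F,
      ‖∑ j, leftRegularRep Γ (v (σ j) * t * (v (σ j))⁻¹)‖ ≤ ε * m := by
  obtain ⟨U, hU, hPU, hUt⟩ := exists_isOpen_disjoint_smul hP F hF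
  -- This Urysohn function dominates the indicator of `Uᶜ` and tends to 0 along every orbit `(v l)⁻¹
  -- • x`.
  obtain ⟨f, hf0, hf1, hf⟩ := exists_continuous_zero_one_of_isClosed hP.isClosed hU.isClosed_compl
    (Set.disjoint_compl_right_iff_subset.2 hPU)
  obtain ⟨m, hm, σ, hσ⟩ := exists_sum_le_mul_of_tendsto_zero
    (fun l => f.comp ⟨fun x => (v l)⁻¹ • x, continuous_const_smul _⟩)
    (fun l x => (hf _).1) (fun l x => (hf _).2)
    (fun x => by
      refine tendsto_order.2 ⟨fun r hr => Eventually.of_forall fun l => hr.trans_le (hf _).1,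
        fun r hr => hv x (f ⁻¹' Set.Iio r) (isOpen_Iio.preimage f.continuous) fun y hy => ?_⟩
      simpa [hf0 hy] using hr)
    -- Chosen so that `2 * √(δ * m * m) = ε * m`.
    (δ := (ε / 2) ^ 2) (by positivity)
  refine ⟨m, hm, σ, fun t ht => ?_⟩
  refine (norm_sum_leftRegularRep_le _ (fun j => {h : Γ | (v (σ j))⁻¹ • h • x₀ ∉ U})
    (c := (ε / 2) ^ 2 * m) (by positivity) (fun h => ?_) (fun j h hh => ?_)).trans_eq ?_
  · refine le_trans (Finset.sum_le_sum fun j _ => ?_) (hσ (h • x₀))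
    by_cases hj : (v (σ j))⁻¹ • h • x₀ ∈ U
    · simpa [hj] using (hf _).1
    · have : f ((v (σ j))⁻¹ • h • x₀) = 1 := hf1 hj
      simp [hj, this]
  · have h1 : (v (σ j))⁻¹ • h • x₀ ∈ U := by simpa using hh
    intro h2
    refine hUt t ht _ h2 ?_
    convert h1 using 1
    simp only [smul_smul]
    group
  · rw [Fintype.card_fin, mul_assoc, ← pow_two, ← mul_pow, Real.sqrt_sq (by positivity)]
    ring

/-- The inverse of an element with north-south dynamics attracts every point to the poles. -/
theorem IsPolePair.eventually_inv_pow_smul_mem {Γ X : Type*} [Group Γ] [TopologicalSpace X]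
    [MulAction Γ X] (hdyn : HasNorthSouthDynamics Γ X) {s : Γ} (hs : ¬ IsOfFinOrder s)
    {xp xm : X} (hx : IsPolePair s xp xm) (x : X) {U : Set X} (hU : IsOpen U)
    (hPU : {xp, xm} ⊆ U) : ∀ᶠ l : ℕ in atTop, (s ^ l)⁻¹ • x ∈ U := by
  -- The poles of `s⁻¹` are those of `s`; which one attracts is immaterial, since `U` contains both.
  obtain ⟨p, q, -, hfix, hlim⟩ := hdyn s⁻¹ (by rwa [isOfFinOrder_inv_iff])
  rw [MulAction.fixedBy_inv, hx.2.1] at hfix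
  rw [hfix] at hPU
  by_cases hxq : x = q
  · subst hxq
    have hq : x ∈ MulAction.fixedBy X s := by rw [hx.2.1, hfix]; simp
    refine Eventually.of_forall fun l => ?_
    have : (s ^ l)⁻¹ • x = x := by
      rw [inv_smul_eq_iff]
      exact (MulAction.mem_fixedBy.1 (MulAction.fixedBy_subset_fixedBy_zpow X s l hq)).symm.trans
        (by rw [zpow_natCast])
    rw [this]
    exact hPU (by simp)
  · simp only [← inv_pow]
    exact (hlim x hxq).eventually (hU.mem_nhds (hPU (Set.mem_insert p _)))

/-! ### Averages of conjugates and reduction to group elements -/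

theorem norm_blockDiag_le {ι Q : Type*} (q : ι → Q) (a : EllTwo ι →L[ℂ] EllTwo ι) :
    ‖EllTwo.blockDiag q a‖ ≤ ‖a‖ :=
  ContinuousLinearMap.opNorm_le_bound _ (norm_nonneg _) fun ξ =>
    EllTwo.norm_le_of_sum_sq _ (by positivity) (EllTwo.sum_block_sq_le q a ξ)

/-- The average of the conjugates of an operator by the unitaries `λ(σ j)`. -/
noncomputable def conjAverage {Γ : Type*} [Group Γ] {m : ℕ} (σ : Fin m → Γ) :
    (EllTwo Γ →L[ℂ] EllTwo Γ) →ₗ[ℂ] (EllTwo Γ →L[ℂ] EllTwo Γ) :=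
  (1 / (m : ℂ)) •
    ∑ j, LinearMap.mulLeftRight ℂ (leftRegularRep Γ (σ j), star (leftRegularRep Γ (σ j)))

theorem conjAverage_apply {Γ : Type*} [Group Γ] {m : ℕ} (σ : Fin m → Γ)
    (a : EllTwo Γ →L[ℂ] EllTwo Γ) : conjAverage σ a = (1 / (m : ℂ)) •
      ∑ j, leftRegularRep Γ (σ j) * a * star (leftRegularRep Γ (σ j)) := by
  simp [conjAverage]

theorem conjAverage_leftRegularRep {Γ : Type*} [Group Γ] {m : ℕ} (σ : Fin m → Γ) (t : Γ) :
    conjAverage σ (leftRegularRep Γ t) =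
      (1 / (m : ℂ)) • ∑ j, leftRegularRep Γ (σ j * t * (σ j)⁻¹) := by
  simp only [conjAverage_apply, star_leftRegularRep, map_mul]

theorem norm_conjAverage_le {Γ : Type*} [Group Γ] {m : ℕ} (σ : Fin m → Γ)
    (a : EllTwo Γ →L[ℂ] EllTwo Γ) : ‖conjAverage σ a‖ ≤ ‖a‖ := by
  rw [conjAverage_apply, norm_smul]
  have h : ‖∑ j, leftRegularRep Γ (σ j) * a * star (leftRegularRep Γ (σ j))‖ ≤ m * ‖a‖ := by
    refine (norm_sum_le_of_le _ (f := fun j => leftRegularRep Γ (σ j) * a *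
      star (leftRegularRep Γ (σ j))) (n := fun _ => ‖a‖) fun j _ => ?_).trans (by simp)
    calc _ ≤ ‖leftRegularRep Γ (σ j)‖ * ‖a‖ * ‖star (leftRegularRep Γ (σ j))‖ :=
          norm_mul₃_le
      _ ≤ 1 * ‖a‖ * 1 := by
          rw [star_leftRegularRep]
          gcongr <;> exact norm_leftRegularRep_le _
      _ = ‖a‖ := by ring
  rcases Nat.eq_zero_or_pos m with rfl | hm
  · simp
  · have hm' : (0 : ℝ) < m := by exact_mod_cast hm
    calc _ ≤ ‖1 / (m : ℂ)‖ * (m * ‖a‖) := mul_le_mul_of_nonneg_left h (norm_nonneg _)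
      _ = ‖a‖ := by simp [hm'.ne']

/-- Both maps are linear contractions, so replacing `a` by `b` costs `‖a - b‖` for each. -/
theorem norm_conjAverage_sub_cosetBlockDiag_le {Γ : Type*} [Group Γ] (H : Subgroup Γ) {m : ℕ}
    (σ : Fin m → Γ) (a b : EllTwo Γ →L[ℂ] EllTwo Γ) :
    ‖conjAverage σ a - cosetBlockDiag H a‖ ≤
      2 * ‖a - b‖ + ‖conjAverage σ b - cosetBlockDiag H b‖ := by
  have h : conjAverage σ a - cosetBlockDiag H a = conjAverage σ (a - b) -
      cosetBlockDiag H (a - b) + (conjAverage σ b - cosetBlockDiag H b) := by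
    rw [map_sub, map_sub]; abel
  rw [h]
  have h1 := norm_conjAverage_le σ (a - b)
  have h2 : ‖cosetBlockDiag H (a - b)‖ ≤ ‖a - b‖ := norm_blockDiag_le _ _
  linarith [norm_add_le (conjAverage σ (a - b) - cosetBlockDiag H (a - b))
    (conjAverage σ b - cosetBlockDiag H b),
    norm_sub_le (conjAverage σ (a - b)) (cosetBlockDiag H (a - b))]

/-- The averaging property on group elements extends to finite linear combinations. -/
theorem norm_conjAverage_sub_cosetBlockDiag_linearCombination_le {Γ : Type*} [Group Γ]
    (H : Subgroup Γ) {m : ℕ} (σ : Fin m → Γ) (c : Γ →₀ ℂ) {δ : ℝ}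
    (h : ∀ t ∈ c.support, ‖conjAverage σ (leftRegularRep Γ t) -
      cosetBlockDiag H (leftRegularRep Γ t)‖ ≤ δ) :
    ‖conjAverage σ (Finsupp.linearCombination ℂ (leftRegularRep Γ) c) -
      cosetBlockDiag H (Finsupp.linearCombination ℂ (leftRegularRep Γ) c)‖ ≤
      (∑ t ∈ c.support, ‖c t‖) * δ := by
  rw [Finsupp.linearCombination_apply, Finsupp.sum, map_sum, map_sum, ← Finset.sum_sub_distrib,
    Finset.sum_mul]
  refine norm_sum_le_of_le _ fun t ht => ?_
  rw [map_smul, map_smul, ← smul_sub, norm_smul]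
  exact mul_le_mul_of_nonneg_left (h t ht) (norm_nonneg _)

theorem conjAverage_leftRegularRep_of_commute {Γ : Type*} [Group Γ] {m : ℕ} (hm : 0 < m)
    (σ : Fin m → Γ) {t : Γ} (h : ∀ j, Commute (σ j) t) :
    conjAverage σ (leftRegularRep Γ t) = leftRegularRep Γ t := by
  have h' : ∀ j, σ j * t * (σ j)⁻¹ = t := fun j => by rw [(h j).eq, mul_inv_cancel_right]
  have hm' : (m : ℂ) ≠ 0 := by exact_mod_cast hm.ne'
  rw [conjAverage_leftRegularRep]
  simp only [h', Finset.sum_const, Finset.card_univ, Fintype.card_fin]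
  rw [← Nat.cast_smul_eq_nsmul ℂ, smul_smul, one_div_mul_cancel hm', one_smul]

theorem mainTheorem7 {Γ X : Type*} [Group Γ] [TopologicalSpace X] [CompactSpace X] [T2Space X]
    [MulAction Γ X] [ContinuousConstSMul Γ X]
    (hdyn : HasNorthSouthDynamics Γ X)
    (s : Γ) (hs : ¬ IsOfFinOrder s)
    (xp xm : X) (hx : IsPolePair s xp xm)
    (hdisj : ∀ t : Γ, t ∉ Subgroup.zpowers s →
      Disjoint ((fun x : X => t • x) '' {xp, xm}) {xp, xm})
    (n : ℕ → ℕ) (hn : StrictMono n)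
    (k : ℕ) (a : Fin k → reducedCStar Γ) (ε : ℝ) (hε : 0 < ε) :
    ∃ m : ℕ, 0 < m ∧ ∃ σ : Fin m → Γ,
      (∀ j, σ j ∈ Set.range (fun l : ℕ => s ^ n l)) ∧
      ∀ i : Fin k,
        ‖(1 / (m : ℂ)) • (∑ j, leftRegularRep Γ (σ j) * (a i : EllTwo Γ →L[ℂ] EllTwo Γ) *
              star (leftRegularRep Γ (σ j)))
            - (canonicalCondExp (Subgroup.zpowers s) (a i) : EllTwo Γ →L[ℂ] EllTwo Γ)‖ < ε := by
  classical
  -- The approximation error counts twice, leaving `ε / 4` for the finite sums and some slack.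
  have happrox : ∀ i, ∃ c : Γ →₀ ℂ, ‖(a i : EllTwo Γ →L[ℂ] EllTwo Γ) -
      Finsupp.linearCombination ℂ (leftRegularRep Γ) c‖ < ε / 4 := by
    intro i
    obtain ⟨b, hb, hab⟩ := Metric.mem_closure_iff.1
      (reducedCStar_subset_closure_span Γ (a i).2) (ε / 4) (by positivity)
    obtain ⟨c, rfl⟩ := (Finsupp.mem_span_range_iff_exists_finsupp).1 hb
    exact ⟨c, by rwa [dist_eq_norm] at hab⟩
  choose c hc using happrox
  let C : ℝ := ∑ i, ∑ t ∈ (c i).support, ‖c i t‖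
  have hC0 : 0 ≤ C := Finset.sum_nonneg fun i _ => Finset.sum_nonneg fun t _ => norm_nonneg _
  have hC : ∀ i, ∑ t ∈ (c i).support, ‖c i t‖ ≤ C := fun i =>
    Finset.single_le_sum (f := fun i => ∑ t ∈ (c i).support, ‖c i t‖)
      (fun i _ => Finset.sum_nonneg fun t _ => norm_nonneg _) (Finset.mem_univ i)
  obtain ⟨m, hm, σ, hσ⟩ := exists_norm_sum_conj_le (P := {xp, xm}) (Set.toFinite _).isCompact xp
    (fun l => s ^ n l)
    (fun x U hU hPU => hn.tendsto_atTop.eventually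
      (hx.eventually_inv_pow_smul_mem hdyn hs x hU hPU))
    -- All off-subgroup elements of all the `c i` are treated together, so that one `σ` serves every
    -- `i`.
    ((Finset.univ.biUnion fun i => (c i).support).filter (· ∉ Subgroup.zpowers s))
    (fun t ht => hdisj t (Finset.mem_filter.1 ht).2)
    -- `C + 1` instead of `C` avoids a zero denominator.
    (ε := ε / (4 * (C + 1))) (by positivity)
  have hm' : (0 : ℝ) < m := by exact_mod_cast hm
  refine ⟨m, hm, fun j => s ^ n (σ j), fun j => ⟨σ j, rfl⟩, fun i => ?_⟩
  rw [← conjAverage_apply]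
  refine (norm_conjAverage_sub_cosetBlockDiag_le (Subgroup.zpowers s) (fun j => s ^ n (σ j))
    (a i : EllTwo Γ →L[ℂ] EllTwo Γ)
    (Finsupp.linearCombination ℂ (leftRegularRep Γ) (c i))).trans_lt ?_
  have hb := norm_conjAverage_sub_cosetBlockDiag_linearCombination_le (Subgroup.zpowers s)
    (fun j => s ^ n (σ j)) (c i) (δ := ε / (4 * (C + 1))) fun t ht => by
      rw [cosetBlockDiag_leftRegularRep]
      split_ifs with hts
      · rw [conjAverage_leftRegularRep_of_commute hm, sub_self, norm_zero]
        · positivity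
        · obtain ⟨z, rfl⟩ := hts
          exact fun j => ((Commute.refl s).pow_left _).zpow_right z
      · rw [sub_zero, conjAverage_leftRegularRep, norm_smul]
        have h1 := hσ t (Finset.mem_filter.2
          ⟨Finset.mem_biUnion.2 ⟨i, Finset.mem_univ i, ht⟩, hts⟩)
        calc _ ≤ ‖1 / (m : ℂ)‖ * (ε / (4 * (C + 1)) * m) :=
              mul_le_mul_of_nonneg_left h1 (norm_nonneg _)
          _ = _ := by
              simp only [norm_div, norm_one, Complex.norm_natCast]
              field_simp
  have hb' : (∑ t ∈ (c i).support, ‖c i t‖) * (ε / (4 * (C + 1))) ≤ ε / 4 := by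
    calc _ ≤ (C + 1) * (ε / (4 * (C + 1))) :=
          mul_le_mul_of_nonneg_right ((hC i).trans (by linarith)) (by positivity)
      _ = ε / 4 := by field_simp
  linarith [hc i]
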